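/- Let $n,M,K\ge 1$, $w\in(0,1]$, let $\Sigma\in\mathbb{R}^{n\times n}$ be symmetric positive definite, let $y_1,\dots,y_M\in\mathbb{R}^n$, and let $B=\prod_{i=1}^n[a_i,b_i]$ be a box with $a_i<b_i$ and volume $V$. Let $$g(x)=(1-w)\frac1M\sum_{j=1}^M \mathcal N(x\mid y_j,\Sigma)+w\,\frac1V\,\mathbf 1_B(x)$$ be the data density $p(x\mid\mathcal E(\theta))$ (in the application, the $y_j$ are points of an ellipsoidal surface $\mathcal E(\theta)$). For $\sigma>0$ and $\xi=(\xi_1,\dots,\xi_K)\in(\mathbb{R}^n)^K$ let $$f(u,\xi)=\frac1K\sum_{i=1}^K\frac{1}{(2\pi\sigma^2)^{n/2}}\exp\Bigl(-\frac{\|u-\xi_i\|^2}{2\sigma^2}\Bigr)$$ be the Gaussian-mixture family without a uniform component, with parameter set $\Theta$, where $\Theta=(\mathbb{R}^n)^K$ or $\Theta\subseteq(\mathbb{R}^n)^K$ is compact. Let $I(g:f,\xi)=\mathbb{E}_{U\sim g}\log\bigl(g(U)/f(U,\xi)\bigr)$. Assume that $\mathbb{E}_{U\sim g}\,g(U)$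 exists and that $I(g:f,\cdot)$ has a unique minimizer $\xi_*$ over $\Theta$. Let $X_1,X_2,\dots$ be i.i.d. with density $g$, and let $\hat\xi_L$ be a quasi-maximum-likelihood estimator, that is, almost surely, for every $L\ge1$, $\hat\xi_L$ maximizes $\frac1L\sum_{i=1}^L\log f(X_i,\xi)$ over $\xi\in\Theta$. Then $\hat\xi_L\to\xi_*$ almost surely as $L\to\infty$. Moreover, $\log(g/f(\cdot,\xi))$ is integrable with respect to $g(x)\,dx$ for every $\xi\in(\mathbb{R}^n)^K$, so that $I(g:f,\xi)$ is finite; $I(g:f,\xi_*)>0$; and for no $\xi\in(\mathbb{R}^n)^K$ are $f(\cdot,\xi)$ and $g$ densities of the same distribution. -/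

import Mathlib

open MeasureTheory ProbabilityTheory Filter Topology

noncomputable section

/-- Density at `x` of the Gaussian distribution on `ℝⁿ` with mean `y` and covariance matrix `S`. -/
def gaussianDensity {n : ℕ} (S : Matrix (Fin n) (Fin n) ℝ)
    (y x : EuclideanSpace ℝ (Fin n)) : ℝ :=
  (Real.sqrt ((2 * Real.pi) ^ n * S.det))⁻¹ *
    Real.exp (-(1 / 2) * ((x - y).ofLp ⬝ᵥ (S⁻¹).mulVec (x - y).ofLp))

/-- The closed axis-parallel box with opposite corners `a` and `b`. -/
def axisBox {n : ℕ} (a b : EuclideanSpace ℝ (Fin n)) : Set (EuclideanSpace ℝ (Fin n)) :=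
  {x | ∀ i, x i ∈ Set.Icc (a i) (b i)}

/-- The volume of the box with opposite corners `a` and `b` (where `a i ≤ b i` for all `i`). -/
def axisBoxVolume {n : ℕ} (a b : EuclideanSpace ℝ (Fin n)) : ℝ :=
  ∏ i, (b i - a i)

/-- Density of the uniform distribution on the box with corners `a` and `b`:
the constant `1 / V` on the box, and `0` off it. -/
def boxUniformDensity {n : ℕ} (a b : EuclideanSpace ℝ (Fin n)) :
    EuclideanSpace ℝ (Fin n) → ℝ :=
  (axisBox a b).indicator fun _ => 1 / axisBoxVolume a b

/-- The data model: an equally weighted mixture of `M` Gaussians with means `y j` and covariance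
`S`, of total weight `1 - w`, plus the uniform distribution on a box, of weight `w`. -/
def dataDensity {n M : ℕ} (w : ℝ) (S : Matrix (Fin n) (Fin n) ℝ)
    (y : Fin M → EuclideanSpace ℝ (Fin n)) (a b : EuclideanSpace ℝ (Fin n))
    (x : EuclideanSpace ℝ (Fin n)) : ℝ :=
  (1 - w) * (1 / (M : ℝ)) * ∑ j, gaussianDensity S (y j) x + w * boxUniformDensity a b x

/-- The family without uniform component: the equally weighted mixture of `K` isotropic Gaussians
with variance `σ ^ 2`. Its parameter `ξ` is the vector of the `K` centers. -/
def mixtureDensity {n K : ℕ} (σ : ℝ) (u : EuclideanSpace ℝ (Fin n))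
    (ξ : Fin K → EuclideanSpace ℝ (Fin n)) : ℝ :=
  1 / (K : ℝ) * ∑ i, 1 / (2 * Real.pi * σ ^ 2) ^ ((n : ℝ) / 2) *
    Real.exp (-(1 / (2 * σ ^ 2)) * ‖u - ξ i‖ ^ 2)

/-- The measure on `ℝⁿ` with Lebesgue density `h` (for `h ≥ 0`). -/
def measureOfDensity {n : ℕ} (h : EuclideanSpace ℝ (Fin n) → ℝ) :
    Measure (EuclideanSpace ℝ (Fin n)) :=
  volume.withDensity fun x => ENNReal.ofReal (h x)

/-- The Kullback-Leibler information criterion `I(g : f, ξ) = E (log (g(U) / f(U, ξ)))`, where `U`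
has density `g`. -/
def klic {n K : ℕ} (g : EuclideanSpace ℝ (Fin n) → ℝ) (σ : ℝ)
    (ξ : Fin K → EuclideanSpace ℝ (Fin n)) : ℝ :=
  ∫ u, Real.log (g u / mixtureDensity σ u ξ) ∂(measureOfDensity g)

/-- The average quasi-log-likelihood of the first `L` observations `x 0, …, x (L - 1)`. -/
def quasiLogLikelihood {n K : ℕ} (σ : ℝ) (x : ℕ → EuclideanSpace ℝ (Fin n)) (L : ℕ)
    (ξ : Fin K → EuclideanSpace ℝ (Fin n)) : ℝ :=
  1 / (L : ℝ) * ∑ i ∈ Finset.range L, Real.log (mixtureDensity σ (x i) ξ)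

/-- `ξ` is a quasi-maximum-likelihood estimate over the parameter set `Θ` from the first `L`
observations. -/
def IsQMLE {n K : ℕ} (σ : ℝ) (Θ : Set (Fin K → EuclideanSpace ℝ (Fin n)))
    (x : ℕ → EuclideanSpace ℝ (Fin n)) (L : ℕ)
    (ξ : Fin K → EuclideanSpace ℝ (Fin n)) : Prop :=
  ξ ∈ Θ ∧ IsMaxOn (quasiLogLikelihood σ x L) Θ ξ

/-- `ξ` is the one and only minimizer of `I` over `Θ`. -/
def IsUniqueMinimizerOn {α : Type*} (I : α → ℝ) (Θ : Set α) (ξ : α) : Prop :=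
  ξ ∈ Θ ∧ IsMinOn I Θ ξ ∧ ∀ ξ' ∈ Θ, IsMinOn I Θ ξ' → ξ' = ξ

end

/-!
Wald's consistency argument, in the compactification in which each center of the mixture has its own
point at infinity. When some centers escape, the mixtures converge pointwise to a mixture that has
lost mass, which lies strictly below a genuine one; so around every limit point other than the
minimizer the log-likelihood has an envelope whose mean is less than the optimal one. By the strong
law of large numbers a neighbourhood of such a limit point eventually contains no maximizer, and
finitely many of these neighbourhoods suffice by compactness. The information is finite because the
data have second moments, and positive by Gibbs' inequality: a continuous density cannot match the
jump of the data density across the boundary of the box.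
-/

section Logarithm

variable {α : Type*} [MeasurableSpace α] {μ : Measure α}

theorem abs_log_le_abs_log_add_abs_log {p v C : ℝ} (hp : 0 < p) (hpv : p ≤ v) (hvC : v ≤ C) :
    |Real.log v| ≤ |Real.log p| + |Real.log C| :=
  (abs_le_max_abs_abs (Real.log_le_log hp hpv) (Real.log_le_log (hp.trans_le hpv) hvC)).trans
    (max_le_add_of_nonneg (abs_nonneg _) (abs_nonneg _))

theorem integrable_log_of_le_of_le [IsFiniteMeasure μ] {p F : α → ℝ} {C : ℝ}
    (hF : AEMeasurable F μ) (hp : ∀ x, 0 < p x) (hpF : ∀ x, p x ≤ F x) (hFC : ∀ x, F x ≤ C)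
    (hlog : Integrable (fun x => Real.log (p x)) μ) :
    Integrable (fun x => Real.log (F x)) μ :=
  (hlog.abs.add (integrable_const |Real.log C|)).mono' hF.log.aestronglyMeasurable
    (ae_of_all μ fun x => abs_log_le_abs_log_add_abs_log (hp x) (hpF x) (hFC x))

theorem integral_lt_integral_of_forall_lt [NeZero μ] {f g : α → ℝ} (hf : Integrable f μ)
    (hg : Integrable g μ) (hlt : ∀ x, f x < g x) : ∫ x, f x ∂μ < ∫ x, g x ∂μ := by
  have hsupp : (Function.support fun x => g x - f x) = Set.univ :=
    Set.eq_univ_of_forall fun x => (sub_pos.2 (hlt x)).ne'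
  rw [← sub_pos, ← integral_sub hg hf, integral_pos_iff_support_of_nonneg
    (fun x => (sub_pos.2 (hlt x)).le) (hg.sub hf), hsupp]
  exact Measure.measure_univ_pos.2 (NeZero.ne μ)

end Logarithm

section Wald

variable {Ω E T Z : Type*} [MeasurableSpace Ω] [MeasurableSpace E] {P : Measure Ω} {μ : Measure E}

/-- Wald's local domination condition: for the parameters `t` near the limit described by the
filter `l`, the criteria `q · t` have a common integrable envelope of mean less than `m`. A filter
in place of a point lets the parameters also escape to infinity. -/
def HasEnvelopeBelow (μ : Measure E) (q : E → T → ℝ) (l : Filter T) (m : ℝ) : Prop :=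
  ∃ H : E → ℝ, Integrable H μ ∧ (∀ᶠ t in l, ∀ u, q u t ≤ H u) ∧ ∫ u, H u ∂μ < m

theorem HasEnvelopeBelow.mono {q : E → T → ℝ} {l : Filter T} {m m' : ℝ}
    (hq : HasEnvelopeBelow μ q l m) (hm : m ≤ m') : HasEnvelopeBelow μ q l m' :=
  hq.imp fun _ h => ⟨h.1, h.2.1, h.2.2.trans_le hm⟩

section StrongLaw

variable {X : ℕ → Ω → E} (hindep : Pairwise fun i j => X i ⟂ᵢ[P] X j)
  (hlaw : ∀ i, HasLaw (X i) μ P)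
include hindep hlaw

theorem ae_tendsto_average_comp {H : E → ℝ} (hH : Integrable H μ) :
    ∀ᵐ ω ∂P, Tendsto (fun L : ℕ => (∑ i ∈ Finset.range L, H (X i ω)) / L) atTop
      (𝓝 (∫ u, H u ∂μ)) := by
  have hmeas : ∀ i, AEMeasurable H (P.map (X i)) := fun i => (hlaw i).map_eq ▸ hH.aemeasurable
  have hint : Integrable (H ∘ X 0) P := by
    rw [← (hlaw 0).map_eq] at hH
    exact hH.comp_aemeasurable (hlaw 0).aemeasurable
  rw [← (hlaw 0).integral_comp hH.aestronglyMeasurable]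
  exact strong_law_ae_real (fun i => H ∘ X i) hint
    (fun i j hij => (hindep hij).comp₀ (hlaw i).aemeasurable (hlaw j).aemeasurable
      (hmeas i) (hmeas j))
    fun i => ((hlaw i).identDistrib (hlaw 0)).comp_of_aemeasurable (hmeas i)

variable {q : E → T → ℝ} {t₀ : T} (hq : Integrable (fun u => q u t₀) μ)
include hq

theorem HasEnvelopeBelow.exists_mem_ae_eventually_sum_lt {l : Filter T}
    (hl : HasEnvelopeBelow μ q l (∫ u, q u t₀ ∂μ)) :
    ∃ V ∈ l, ∀ᵐ ω ∂P, ∀ᶠ L : ℕ in atTop, ∀ t ∈ V,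
      ∑ i ∈ Finset.range L, q (X i ω) t < ∑ i ∈ Finset.range L, q (X i ω) t₀ := by
  obtain ⟨H, hH, hle, hlt⟩ := hl
  refine ⟨_, hle, ?_⟩
  filter_upwards [ae_tendsto_average_comp hindep hlaw hH, ae_tendsto_average_comp hindep hlaw hq]
    with ω hωH hωq
  filter_upwards [hωH.eventually_lt hωq hlt, eventually_gt_atTop 0] with L hL hL0 t ht
  exact (Finset.sum_le_sum fun i _ => ht (X i ω)).trans_lt
    ((div_lt_div_iff_of_pos_right (Nat.cast_pos.2 hL0)).1 hL)

variable [TopologicalSpace Z] {C : Set Z} (hC : IsCompact C) {ι : T → Z}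
include hC

theorem ae_eventually_sum_lt_of_isCompact
    (henv : ∀ z ∈ C, HasEnvelopeBelow μ q (comap ι (𝓝 z)) (∫ u, q u t₀ ∂μ)) :
    ∀ᵐ ω ∂P, ∀ᶠ L : ℕ in atTop, ∀ t, ι t ∈ C →
      ∑ i ∈ Finset.range L, q (X i ω) t < ∑ i ∈ Finset.range L, q (X i ω) t₀ := by
  refine hC.induction_on (p := fun A => ∀ᵐ ω ∂P, ∀ᶠ L : ℕ in atTop, ∀ t, ι t ∈ A →
    ∑ i ∈ Finset.range L, q (X i ω) t < ∑ i ∈ Finset.range L, q (X i ω) t₀) ?_ ?_ ?_ ?_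
  · simp only [Set.mem_empty_iff_false, false_implies, implies_true, eventually_true]
  · intro A B hAB hB
    filter_upwards [hB] with ω hω
    filter_upwards [hω] with L hL t ht using hL t (hAB ht)
  · intro A B hA hB
    filter_upwards [hA, hB] with ω hωA hωB
    filter_upwards [hωA, hωB] with L hLA hLB t ht using ht.elim (hLA t) (hLB t)
  · intro z hz
    obtain ⟨V, ⟨W, hW, hWV⟩, hV⟩ := (henv z hz).exists_mem_ae_eventually_sum_lt hindep hlaw hq
    refine ⟨W, mem_nhdsWithin_of_mem_nhds hW, ?_⟩
    filter_upwards [hV] with ω hω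
    filter_upwards [hω] with L hL t ht using hL t (hWV ht)

theorem ae_tendsto_of_sum_le [TopologicalSpace T] [FirstCountableTopology T]
    (hι : IsInducing ι)
    (henv : ∀ z ∈ C, z ≠ ι t₀ → HasEnvelopeBelow μ q (comap ι (𝓝 z)) (∫ u, q u t₀ ∂μ))
    {that : ℕ → Ω → T}
    (hthat : ∀ᵐ ω ∂P, ∀ L : ℕ, 0 < L → ι (that L ω) ∈ C ∧
      ∑ i ∈ Finset.range L, q (X i ω) t₀ ≤ ∑ i ∈ Finset.range L, q (X i ω) (that L ω)) :
    ∀ᵐ ω ∂P, Tendsto (fun L => that L ω) atTop (𝓝 t₀) := by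
  have hsep : ∀ U : Set Z, IsOpen U → ι t₀ ∈ U →
      ∀ᵐ ω ∂P, ∀ᶠ L : ℕ in atTop, that L ω ∈ ι ⁻¹' U := by
    intro U hU ht₀
    have hlt := ae_eventually_sum_lt_of_isCompact hindep hlaw hq (hC.diff hU) (ι := ι)
      fun z hz => henv z hz.1 fun h => hz.2 (h ▸ ht₀)
    filter_upwards [hlt, hthat] with ω hω hωthat
    filter_upwards [hω, eventually_gt_atTop 0] with L hL hL0
    by_contra hmem
    exact (hL _ ⟨(hωthat L hL0).1, hmem⟩).not_ge (hωthat L hL0).2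
  obtain ⟨V, hV⟩ := (𝓝 t₀).exists_antitone_basis
  have hmem : ∀ k, ∀ᵐ ω ∂P, ∀ᶠ L : ℕ in atTop, that L ω ∈ V k := by
    intro k
    obtain ⟨W, hWV, hW, ht₀⟩ := mem_nhds_iff.1 (hV.1.mem_of_mem (i := k) trivial)
    obtain ⟨U, hU, rfl⟩ := hι.isOpen_iff.1 hW
    filter_upwards [hsep U hU ht₀] with ω hω using hω.mono fun L hL => hWV hL
  filter_upwards [ae_all_iff.2 hmem] with ω hω
  exact hV.1.tendsto_right_iff.2 fun k _ => hω k

end StrongLaw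

end Wald

section EnvelopeCriterion

variable {E T : Type*} {l : Filter T}

theorem tendsto_max_iSup_of_hasAntitoneBasis {V : ℕ → Set T} (hV : l.HasAntitoneBasis V)
    {f : T → ℝ} {p : ℝ} (hp : 0 ≤ p) (hlim : ∀ c, p < c → ∀ᶠ t in l, f t < c) :
    Tendsto (fun k => max (⨆ t : V k, f t) p) atTop (𝓝 p) := by
  refine tendsto_order.2
    ⟨fun c hc => Eventually.of_forall fun k => hc.trans_le (le_max_right _ _), fun c hc => ?_⟩
  obtain ⟨d, hpd, hdc⟩ := exists_between hc
  filter_upwards [hV.eventually_subset (hlim d hpd)] with k hk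
  exact max_lt ((Real.iSup_le (fun t => (hk t.2).le) (hp.trans hpd.le)).trans_lt hdc) hc

variable [TopologicalSpace E] [MeasurableSpace E] [OpensMeasurableSpace E] {μ : Measure E}
  [IsFiniteMeasure μ] [l.IsCountablyGenerated] {f : E → T → ℝ} {p : E → ℝ} {C : ℝ}
  (hf : ∀ t, LowerSemicontinuous fun u => f u t) (hf0 : ∀ u t, 0 < f u t)
  (hfC : ∀ u t, f u t ≤ C) (hpm : Measurable p) (hpC : ∀ u, p u ≤ C)
  (hlog : Integrable (fun u => Real.log (p u)) μ)
include hf hf0 hfC hpm hpC hlog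

theorem hasEnvelopeBelow_log (hp : ∀ u, 0 < p u)
    (hlim : ∀ u c, p u < c → ∀ᶠ t in l, f u t < c) {m : ℝ} (hm : ∫ u, Real.log (p u) ∂μ < m) :
    HasEnvelopeBelow μ (fun u t => Real.log (f u t)) l m := by
  obtain ⟨V, hV⟩ := l.exists_antitone_basis
  set F : ℕ → E → ℝ := fun k u => max (⨆ t : V k, f u t) (p u)
  have hbdd : ∀ k u, BddAbove (Set.range fun t : V k => f u t) :=
    fun k u => ⟨C, Set.forall_mem_range.2 fun t => hfC u t⟩
  have hFm : ∀ k, Measurable (F k) := fun k =>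
    (lowerSemicontinuous_ciSup (hbdd k) fun t : V k => hf t).measurable.max hpm
  have hpF : ∀ k u, p u ≤ F k u := fun k u => le_max_right _ _
  have hFC : ∀ k u, F k u ≤ C := fun k u =>
    max_le (Real.iSup_le (fun t => hfC u t) ((hp u).le.trans (hpC u))) (hpC u)
  have hFint : Tendsto (fun k => ∫ u, Real.log (F k u) ∂μ) atTop (𝓝 (∫ u, Real.log (p u) ∂μ)) :=
    tendsto_integral_of_dominated_convergence _ (fun k => (hFm k).log.aestronglyMeasurable)
      (hlog.abs.add (integrable_const |Real.log C|))
      (fun k => ae_of_all μ fun u => abs_log_le_abs_log_add_abs_log (hp u) (hpF k u) (hFC k u))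
      (ae_of_all μ fun u =>
        (tendsto_max_iSup_of_hasAntitoneBasis hV (hp u).le (hlim u)).log (hp u).ne')
  obtain ⟨k, hk⟩ := (hFint.eventually_lt_const hm).exists
  refine ⟨fun u => Real.log (F k u),
    integrable_log_of_le_of_le (hFm k).aemeasurable hp (hpF k) (hFC k) hlog, ?_, hk⟩
  filter_upwards [hV.1.mem_of_mem (i := k) trivial] with t ht u
  exact Real.log_le_log (hf0 u t)
    ((le_ciSup (hbdd k u) (⟨t, ht⟩ : V k)).trans (le_max_left _ _))

-- The midpoint of the limit and `p` still dominates near `l`, and its logarithm is integrable even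
-- where the limit vanishes.
theorem hasEnvelopeBelow_log_of_tendsto_lt [NeZero μ] {a : E → ℝ} (ham : Measurable a)
    (ha : ∀ u, 0 ≤ a u) (hap : ∀ u, a u < p u) (hlim : ∀ u, Tendsto (f u) l (𝓝 (a u))) :
    HasEnvelopeBelow μ (fun u t => Real.log (f u t)) l (∫ u, Real.log (p u) ∂μ) := by
  have hp : ∀ u, 0 < p u := fun u => (ha u).trans_lt (hap u)
  have hmid : ∀ u, 0 < (a u + p u) / 2 := fun u =>
    half_pos (add_pos_of_nonneg_of_pos (ha u) (hp u))
  have hmidp : ∀ u, (a u + p u) / 2 < p u := fun u => add_div_two_lt_right.2 (hap u)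
  have hmidC : ∀ u, (a u + p u) / 2 ≤ C := fun u => (hmidp u).le.trans (hpC u)
  have hmidm : Measurable fun u => (a u + p u) / 2 := (ham.add hpm).div_const 2
  have hhalf : Integrable (fun u => Real.log (p u / 2)) μ := by
    simp only [Real.log_div (hp _).ne' two_ne_zero]
    exact hlog.sub (integrable_const (Real.log 2))
  have hmidlog : Integrable (fun u => Real.log ((a u + p u) / 2)) μ :=
    integrable_log_of_le_of_le hmidm.aemeasurable (fun u => half_pos (hp u))
      (fun u => by linarith only [ha u]) hmidC hhalf
  refine hasEnvelopeBelow_log hf hf0 hfC hmidm hmidC hmidlog hmid (fun u c hc => ?_)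
    (integral_lt_integral_of_forall_lt hmidlog hlog fun u => Real.log_lt_log (hmid u) (hmidp u))
  exact (hlim u).eventually_lt_const ((left_lt_add_div_two.2 (hap u)).trans hc)

end EnvelopeCriterion

section QuadraticForm

theorem exists_pos_mul_norm_sq_le_inner {E : Type*} [NormedAddCommGroup E] [InnerProductSpace ℝ E]
    [FiniteDimensional ℝ E] (A : E →L[ℝ] E) (hA : ∀ x, x ≠ 0 → 0 < inner ℝ x (A x)) :
    ∃ c : ℝ, 0 < c ∧ ∀ x, c * ‖x‖ ^ 2 ≤ inner ℝ x (A x) := by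
  rcases (Metric.sphere (0 : E) 1).eq_empty_or_nonempty with hempty | hne
  · have : Subsingleton E := not_nontrivial_iff_subsingleton.1 fun _ =>
      (NormedSpace.sphere_nonempty.2 zero_le_one).ne_empty hempty
    exact ⟨1, one_pos, fun x => by simp [Subsingleton.elim x 0]⟩
  obtain ⟨x₀, hx₀, hmin⟩ := (isCompact_sphere (0 : E) 1).exists_isMinOn hne
    (f := fun x => inner ℝ x (A x)) (by fun_prop)
  refine ⟨inner ℝ x₀ (A x₀), hA x₀ (ne_zero_of_mem_unit_sphere ⟨x₀, hx₀⟩), fun x => ?_⟩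
  rcases eq_or_ne x 0 with rfl | hx
  · simp
  have hle : inner ℝ x₀ (A x₀) ≤ inner ℝ (‖x‖⁻¹ • x) (A (‖x‖⁻¹ • x)) :=
    hmin (show ‖x‖⁻¹ • x ∈ Metric.sphere 0 1 by simp [norm_smul, hx])
  rwa [map_smul, real_inner_smul_left, real_inner_smul_right, ← mul_assoc, ← sq, inv_pow,
    le_inv_mul_iff₀' (pow_pos (norm_pos_iff.2 hx) 2)] at hle

theorem integrable_exp_neg_mul_norm_sq {V : Type*} [NormedAddCommGroup V] [InnerProductSpace ℝ V]
    [FiniteDimensional ℝ V] [MeasurableSpace V] [BorelSpace V] {c : ℝ} (hc : 0 < c) :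
    Integrable fun x : V => Real.exp (-c * ‖x‖ ^ 2) :=
  .of_integral_ne_zero (by
    rw [GaussianFourier.integral_rexp_neg_mul_sq_norm hc]
    positivity)

theorem integrable_norm_sq_mul_exp_neg_mul_norm_sq {V : Type*} [NormedAddCommGroup V]
    [InnerProductSpace ℝ V] [FiniteDimensional ℝ V] [MeasurableSpace V] [BorelSpace V] {c : ℝ}
    (hc : 0 < c) : Integrable fun x : V => ‖x‖ ^ 2 * Real.exp (-c * ‖x‖ ^ 2) := by
  refine ((integrable_exp_neg_mul_norm_sq (half_pos hc)).const_mul (2 / c)).mono' (by fun_prop)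
    (ae_of_all _ fun x => ?_)
  have hexp : c / 2 * ‖x‖ ^ 2 ≤ Real.exp (c / 2 * ‖x‖ ^ 2) :=
    (le_add_of_nonneg_right zero_le_one).trans (Real.add_one_le_exp _)
  rw [Real.norm_of_nonneg (by positivity)]
  calc ‖x‖ ^ 2 * Real.exp (-c * ‖x‖ ^ 2)
      = 2 / c * (c / 2 * ‖x‖ ^ 2) * Real.exp (-c * ‖x‖ ^ 2) := by field_simp
    _ ≤ 2 / c * Real.exp (c / 2 * ‖x‖ ^ 2) * Real.exp (-c * ‖x‖ ^ 2) := by gcongr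
    _ = 2 / c * Real.exp (-(c / 2) * ‖x‖ ^ 2) := by
      rw [mul_assoc, ← Real.exp_add]
      ring_nf

end QuadraticForm

section GaussianDensity

variable {n : ℕ} {S : Matrix (Fin n) (Fin n) ℝ}

/-- The largest value of the density of a Gaussian distribution with covariance matrix `S`, attained
at its mean. -/
noncomputable def gaussianPeak (S : Matrix (Fin n) (Fin n) ℝ) : ℝ :=
  (Real.sqrt ((2 * Real.pi) ^ n * S.det))⁻¹

theorem gaussianPeak_nonneg (S : Matrix (Fin n) (Fin n) ℝ) : 0 ≤ gaussianPeak S :=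
  inv_nonneg.2 (Real.sqrt_nonneg _)

theorem gaussianPeak_pos (hS : S.PosDef) : 0 < gaussianPeak S :=
  inv_pos.2 (Real.sqrt_pos.2 (mul_pos (by positivity) hS.det_pos))

theorem gaussianDensity_eq_mul_exp (S : Matrix (Fin n) (Fin n) ℝ)
    (y x : EuclideanSpace ℝ (Fin n)) :
    gaussianDensity S y x = gaussianPeak S *
      Real.exp (-(1 / 2) * inner ℝ (x - y) (Matrix.toEuclideanCLM (𝕜 := ℝ) S⁻¹ (x - y))) := by
  rw [gaussianDensity, gaussianPeak, Matrix.inner_toEuclideanCLM]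

theorem continuous_gaussianDensity (S : Matrix (Fin n) (Fin n) ℝ) :
    Continuous fun p : EuclideanSpace ℝ (Fin n) × EuclideanSpace ℝ (Fin n) =>
      gaussianDensity S p.1 p.2 := by
  simp only [gaussianDensity_eq_mul_exp S]
  fun_prop

theorem gaussianDensity_nonneg (S : Matrix (Fin n) (Fin n) ℝ) (y x : EuclideanSpace ℝ (Fin n)) :
    0 ≤ gaussianDensity S y x :=
  mul_nonneg (gaussianPeak_nonneg S) (Real.exp_pos _).le

theorem gaussianDensity_pos (hS : S.PosDef) (y x : EuclideanSpace ℝ (Fin n)) :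
    0 < gaussianDensity S y x :=
  mul_pos (gaussianPeak_pos hS) (Real.exp_pos _)

theorem exists_gaussianDensity_le_mul_exp (hS : S.PosDef) :
    ∃ c > 0, ∀ y x, gaussianDensity S y x ≤
      gaussianPeak S * Real.exp (-c * ‖x - y‖ ^ 2) := by
  obtain ⟨c, hc, hle⟩ := exists_pos_mul_norm_sq_le_inner (Matrix.toEuclideanCLM (𝕜 := ℝ) S⁻¹)
    fun x hx => by
      simpa [Matrix.inner_toEuclideanCLM] using
        hS.inv.dotProduct_mulVec_pos (x := x.ofLp) (by simpa using hx)
  refine ⟨c / 2, half_pos hc, fun y x => ?_⟩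
  rw [gaussianDensity_eq_mul_exp]
  exact mul_le_mul_of_nonneg_left (Real.exp_le_exp.2 (by linarith only [hle (x - y)]))
    (gaussianPeak_nonneg S)

theorem gaussianDensity_le (hS : S.PosDef) (y x : EuclideanSpace ℝ (Fin n)) :
    gaussianDensity S y x ≤ gaussianPeak S := by
  obtain ⟨c, hc, hle⟩ := exists_gaussianDensity_le_mul_exp hS
  refine (hle y x).trans (mul_le_of_le_one_right (gaussianPeak_nonneg S) ?_)
  exact Real.exp_le_one_iff.2 (mul_nonpos_of_nonpos_of_nonneg (neg_nonpos.2 hc.le) (sq_nonneg _))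

theorem tendsto_gaussianDensity_cocompact (hS : S.PosDef) (x : EuclideanSpace ℝ (Fin n)) :
    Tendsto (fun y => gaussianDensity S y x) (cocompact _) (𝓝 0) := by
  obtain ⟨c, hc, hle⟩ := exists_gaussianDensity_le_mul_exp hS
  have hnorm : Tendsto (fun y => ‖x - y‖ ^ 2) (cocompact (EuclideanSpace ℝ (Fin n))) atTop :=
    (tendsto_pow_atTop two_ne_zero).comp
      (tendsto_norm_cocompact_atTop.comp (Homeomorph.subLeft x).isClosedEmbedding.tendsto_cocompact)
  have hexp := (Real.tendsto_exp_atBot.comp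
    (hnorm.const_mul_atTop_of_neg (neg_lt_zero.2 hc))).const_mul (gaussianPeak S)
  rw [mul_zero] at hexp
  exact squeeze_zero (fun y => gaussianDensity_nonneg S y x) (fun y => hle y x) hexp

theorem integrable_norm_sq_mul_gaussianDensity (hS : S.PosDef) (y : EuclideanSpace ℝ (Fin n)) :
    Integrable fun x => ‖x‖ ^ 2 * gaussianDensity S y x := by
  obtain ⟨c, hc, hle⟩ := exists_gaussianDensity_le_mul_exp hS
  have hcont := (continuous_gaussianDensity S).comp (Continuous.prodMk_right y)
  have hdom : Integrable fun x : EuclideanSpace ℝ (Fin n) =>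
      2 * gaussianPeak S * (‖x‖ ^ 2 * Real.exp (-c * ‖x‖ ^ 2)) +
        2 * gaussianPeak S * ‖y‖ ^ 2 * Real.exp (-c * ‖x‖ ^ 2) :=
    ((integrable_norm_sq_mul_exp_neg_mul_norm_sq hc).const_mul _).add
      ((integrable_exp_neg_mul_norm_sq hc).const_mul _)
  refine (hdom.comp_sub_right y).mono' ((continuous_norm.pow 2).mul hcont).aestronglyMeasurable
    (ae_of_all _ fun x => ?_)
  have hsq : ‖x‖ ^ 2 ≤ 2 * (‖x - y‖ ^ 2 + ‖y‖ ^ 2) :=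
    (pow_le_pow_left₀ (norm_nonneg x) (norm_le_norm_sub_add x y) 2).trans add_sq_le
  rw [Real.norm_of_nonneg (mul_nonneg (sq_nonneg _) (gaussianDensity_nonneg S y x))]
  calc ‖x‖ ^ 2 * gaussianDensity S y x
      ≤ 2 * (‖x - y‖ ^ 2 + ‖y‖ ^ 2) *
          (gaussianPeak S * Real.exp (-c * ‖x - y‖ ^ 2)) := by
        gcongr
        · exact gaussianDensity_nonneg S y x
        · exact hle y x
    _ = _ := by ring

theorem integrable_log_gaussianDensity (hS : S.PosDef) {μ : Measure (EuclideanSpace ℝ (Fin n))}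
    [IsFiniteMeasure μ] (hμ : MemLp id 2 μ) (y : EuclideanSpace ℝ (Fin n)) :
    Integrable (fun x => Real.log (gaussianDensity S y x)) μ := by
  set A := Matrix.toEuclideanCLM (𝕜 := ℝ) S⁻¹
  have hsq : Integrable (fun x => ‖A‖ * ‖x - y‖ ^ 2) μ :=
    ((memLp_two_iff_integrable_sq_norm (by fun_prop)).1 (hμ.sub (memLp_const y))).const_mul ‖A‖
  have hquad : Integrable (fun x => inner ℝ (x - y) (A (x - y))) μ := by
    refine hsq.mono' (by fun_prop) (ae_of_all _ fun x => ?_)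
    calc ‖inner ℝ (x - y) (A (x - y))‖ ≤ ‖x - y‖ * (‖A‖ * ‖x - y‖) :=
          (norm_inner_le_norm _ _).trans (by gcongr; exact A.le_opNorm _)
      _ = ‖A‖ * ‖x - y‖ ^ 2 := by ring
  simp only [gaussianDensity_eq_mul_exp S, Real.log_mul (gaussianPeak_pos hS).ne'
    (Real.exp_pos _).ne', Real.log_exp]
  exact (integrable_const _).add (hquad.const_mul _)

end GaussianDensity

section Compactification

variable {ι E : Type*}

/-- The family of points `ξ`, viewed in the compact space in which each point may separately escape
to infinity. -/
def toOnePoint (ξ : ι → E) : ι → OnePoint E := fun i => ξ i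

theorem isInducing_toOnePoint [TopologicalSpace E] :
    IsInducing (toOnePoint : (ι → E) → ι → OnePoint E) :=
  .piMap fun _ => OnePoint.isOpenEmbedding_coe.isInducing

theorem mem_range_toOnePoint_or_exists_eq_infty (z : ι → OnePoint E) :
    z ∈ Set.range toOnePoint ∨ ∃ i, z i = OnePoint.infty := by
  refine or_iff_not_imp_right.2 fun hz => ?_
  choose ξ hξ using fun i => OnePoint.ne_infty_iff_exists.1 (not_exists.1 hz i)
  exact ⟨ξ, funext hξ⟩

theorem isCountablyGenerated_comap_toOnePoint_nhds [Countable ι] [NormedAddCommGroup E]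
    [ProperSpace E] (z : ι → OnePoint E) :
    (comap (toOnePoint : (ι → E) → ι → OnePoint E) (𝓝 z)).IsCountablyGenerated := by
  have hcoord : ∀ i, (comap ((↑) : E → OnePoint E) (𝓝 (z i))).IsCountablyGenerated := by
    intro i
    induction z i with
    | infty =>
      rw [OnePoint.comap_coe_nhds_infty, coclosedCompact_eq_cocompact,
        ← Metric.cobounded_eq_cocompact, ← comap_norm_atTop]
      infer_instance
    | coe y =>
      rw [OnePoint.comap_coe_nhds]
      infer_instance
  have hpi : comap (toOnePoint : (ι → E) → ι → OnePoint E) (𝓝 z) =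
      Filter.pi fun i => comap (↑) (𝓝 (z i)) := by
    simp only [nhds_pi, Filter.pi, comap_iInf, comap_comap, Function.comp_def, toOnePoint]
  rw [hpi]
  infer_instance

end Compactification

section GaussianMixture

variable {n : ℕ} {ι : Type*} [Fintype ι] {S : Matrix (Fin n) (Fin n) ℝ}

/-- The density at `x` of the equally weighted mixture of the Gaussian distributions with covariance
matrix `S` and means `ξ i`. -/
noncomputable def gaussianMixture (S : Matrix (Fin n) (Fin n) ℝ)
    (ξ : ι → EuclideanSpace ℝ (Fin n)) (x : EuclideanSpace ℝ (Fin n)) : ℝ :=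
  (Fintype.card ι : ℝ)⁻¹ * ∑ i, gaussianDensity S (ξ i) x

/-- The Gaussian mixture whose centers may lie at infinity, where they carry no mass. It is the
pointwise limit of Gaussian mixtures whose centers may escape to infinity. -/
noncomputable def extendedGaussianMixture (S : Matrix (Fin n) (Fin n) ℝ)
    (z : ι → OnePoint (EuclideanSpace ℝ (Fin n))) (x : EuclideanSpace ℝ (Fin n)) : ℝ :=
  (Fintype.card ι : ℝ)⁻¹ * ∑ i, (z i).elim 0 fun y => gaussianDensity S y x

theorem continuous_extendedGaussianMixture (S : Matrix (Fin n) (Fin n) ℝ)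
    (z : ι → OnePoint (EuclideanSpace ℝ (Fin n))) : Continuous (extendedGaussianMixture S z) := by
  refine continuous_const.mul (continuous_finsetSum _ fun i _ => ?_)
  induction z i with
  | infty => exact continuous_const
  | coe y => exact (continuous_gaussianDensity S).comp (Continuous.prodMk_right y)

theorem continuous_gaussianMixture (S : Matrix (Fin n) (Fin n) ℝ)
    (ξ : ι → EuclideanSpace ℝ (Fin n)) : Continuous (gaussianMixture S ξ) :=
  continuous_extendedGaussianMixture S (toOnePoint ξ)

theorem extendedGaussianMixture_nonneg (S : Matrix (Fin n) (Fin n) ℝ)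
    (z : ι → OnePoint (EuclideanSpace ℝ (Fin n))) (x : EuclideanSpace ℝ (Fin n)) :
    0 ≤ extendedGaussianMixture S z x := by
  refine mul_nonneg (by positivity) (Finset.sum_nonneg fun i _ => ?_)
  induction z i with
  | infty => exact le_rfl
  | coe y => exact gaussianDensity_nonneg S y x

theorem tendsto_elim_gaussianDensity (hS : S.PosDef) (z : OnePoint (EuclideanSpace ℝ (Fin n)))
    (x : EuclideanSpace ℝ (Fin n)) :
    Tendsto (fun y => gaussianDensity S y x) (comap (↑) (𝓝 z))
      (𝓝 (z.elim 0 fun y => gaussianDensity S y x)) := by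
  induction z with
  | infty =>
    rw [OnePoint.comap_coe_nhds_infty, coclosedCompact_eq_cocompact]
    exact tendsto_gaussianDensity_cocompact hS x
  | coe y =>
    rw [OnePoint.comap_coe_nhds]
    exact ((continuous_gaussianDensity S).comp (Continuous.prodMk_left x)).tendsto y

theorem tendsto_gaussianMixture (hS : S.PosDef) (z : ι → OnePoint (EuclideanSpace ℝ (Fin n)))
    (x : EuclideanSpace ℝ (Fin n)) :
    Tendsto (fun ξ => gaussianMixture S ξ x) (comap toOnePoint (𝓝 z))
      (𝓝 (extendedGaussianMixture S z x)) := by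
  have hcoord : ∀ i, Tendsto (fun ξ : ι → EuclideanSpace ℝ (Fin n) => ξ i)
      (comap toOnePoint (𝓝 z)) (comap (↑) (𝓝 (z i))) := fun i =>
    tendsto_comap_iff.2 (((continuous_apply i).tendsto z).comp tendsto_comap)
  exact (tendsto_finsetSum _ fun i _ =>
    (tendsto_elim_gaussianDensity hS (z i) x).comp (hcoord i)).const_mul _

section Nonempty

variable [Nonempty ι]

theorem gaussianMixture_pos (hS : S.PosDef) (ξ : ι → EuclideanSpace ℝ (Fin n))
    (x : EuclideanSpace ℝ (Fin n)) : 0 < gaussianMixture S ξ x :=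
  mul_pos (by positivity) (Finset.sum_pos (fun i _ => gaussianDensity_pos hS (ξ i) x)
    Finset.univ_nonempty)

theorem gaussianMixture_le (hS : S.PosDef) (ξ : ι → EuclideanSpace ℝ (Fin n))
    (x : EuclideanSpace ℝ (Fin n)) : gaussianMixture S ξ x ≤ gaussianPeak S := by
  rw [gaussianMixture, inv_mul_le_iff₀ (by positivity), ← nsmul_eq_mul]
  exact Finset.sum_le_card_nsmul _ _ _ fun i _ => gaussianDensity_le hS (ξ i) x

theorem integrable_log_gaussianMixture (hS : S.PosDef)
    {μ : Measure (EuclideanSpace ℝ (Fin n))} [IsFiniteMeasure μ] (hμ : MemLp id 2 μ)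
    (ξ : ι → EuclideanSpace ℝ (Fin n)) :
    Integrable (fun x => Real.log (gaussianMixture S ξ x)) μ := by
  obtain ⟨i⟩ := ‹Nonempty ι›
  have hcard : 0 < (Fintype.card ι : ℝ)⁻¹ := inv_pos.2 (Nat.cast_pos.2 (Fintype.card_pos_iff.2 ⟨i⟩))
  have hle : ∀ x, (Fintype.card ι : ℝ)⁻¹ * gaussianDensity S (ξ i) x ≤ gaussianMixture S ξ x :=
    fun x => mul_le_mul_of_nonneg_left (Finset.single_le_sum
      (f := fun j => gaussianDensity S (ξ j) x) (fun j _ => gaussianDensity_nonneg S (ξ j) x)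
      (Finset.mem_univ i)) hcard.le
  refine integrable_log_of_le_of_le (continuous_gaussianMixture S ξ).aemeasurable
    (fun x => mul_pos hcard (gaussianDensity_pos hS (ξ i) x)) hle (gaussianMixture_le hS ξ) ?_
  simp only [Real.log_mul hcard.ne' (gaussianDensity_pos hS _ _).ne']
  exact (integrable_const _).add (integrable_log_gaussianDensity hS hμ (ξ i))

variable {μ : Measure (EuclideanSpace ℝ (Fin n))} [IsFiniteMeasure μ]

theorem hasEnvelopeBelow_log_gaussianMixture_coe (hS : S.PosDef) (hμ : MemLp id 2 μ)
    (ξ : ι → EuclideanSpace ℝ (Fin n)) {m : ℝ} (hm : ∫ x, Real.log (gaussianMixture S ξ x) ∂μ < m) :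
    HasEnvelopeBelow μ (fun x η => Real.log (gaussianMixture S η x))
      (comap toOnePoint (𝓝 (toOnePoint ξ))) m := by
  have := isCountablyGenerated_comap_toOnePoint_nhds (toOnePoint ξ)
  exact hasEnvelopeBelow_log (fun η => (continuous_gaussianMixture S η).lowerSemicontinuous)
    (fun x η => gaussianMixture_pos hS η x) (fun x η => gaussianMixture_le hS η x)
    (continuous_gaussianMixture S ξ).measurable (gaussianMixture_le hS ξ)
    (integrable_log_gaussianMixture hS hμ ξ) (gaussianMixture_pos hS ξ)
    (fun x c hc => (tendsto_gaussianMixture hS _ x).eventually_lt_const hc) hm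

theorem exists_extendedGaussianMixture_lt (hS : S.PosDef)
    {z : ι → OnePoint (EuclideanSpace ℝ (Fin n))} (hz : ∃ i, z i = OnePoint.infty) :
    ∃ ξ : ι → EuclideanSpace ℝ (Fin n),
      ∀ x, extendedGaussianMixture S z x < gaussianMixture S ξ x := by
  obtain ⟨i, hi⟩ := hz
  refine ⟨fun j => (z j).elim 0 id, fun x => ?_⟩
  have hle : ∀ j, (z j).elim 0 (fun y => gaussianDensity S y x) ≤
      gaussianDensity S ((z j).elim 0 id) x := by
    intro j
    induction z j with
    | infty => exact gaussianDensity_nonneg S _ x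
    | coe y => exact le_refl (gaussianDensity S y x)
  have hlt : (z i).elim 0 (fun y => gaussianDensity S y x) <
      gaussianDensity S ((z i).elim 0 id) x := by
    rw [hi]
    exact gaussianDensity_pos hS _ x
  exact mul_lt_mul_of_pos_left
    (Finset.sum_lt_sum (fun j _ => hle j) ⟨i, Finset.mem_univ i, hlt⟩)
    (inv_pos.2 (Nat.cast_pos.2 Fintype.card_pos))

theorem exists_hasEnvelopeBelow_log_gaussianMixture_infty [NeZero μ] (hS : S.PosDef)
    (hμ : MemLp id 2 μ) {z : ι → OnePoint (EuclideanSpace ℝ (Fin n))}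
    (hz : ∃ i, z i = OnePoint.infty) :
    ∃ ξ : ι → EuclideanSpace ℝ (Fin n),
      HasEnvelopeBelow μ (fun x η => Real.log (gaussianMixture S η x))
        (comap toOnePoint (𝓝 z))
        (∫ x, Real.log (gaussianMixture S ξ x) ∂μ) := by
  have := isCountablyGenerated_comap_toOnePoint_nhds z
  obtain ⟨ξ, hξ⟩ := exists_extendedGaussianMixture_lt hS hz
  exact ⟨ξ, hasEnvelopeBelow_log_of_tendsto_lt
    (fun η => (continuous_gaussianMixture S η).lowerSemicontinuous)
    (fun x η => gaussianMixture_pos hS η x) (fun x η => gaussianMixture_le hS η x)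
    (continuous_gaussianMixture S ξ).measurable (gaussianMixture_le hS ξ)
    (integrable_log_gaussianMixture hS hμ ξ) (continuous_extendedGaussianMixture S z).measurable
    (extendedGaussianMixture_nonneg S z) hξ (tendsto_gaussianMixture hS z)⟩

-- For unbounded `Θ` each center is compactified separately, because some centers may converge while
-- others escape.
theorem ae_tendsto_of_sum_log_gaussianMixture_le [NeZero μ] (hS : S.PosDef) (hμ : MemLp id 2 μ)
    {Ω : Type*} [MeasurableSpace Ω] {P : Measure Ω} {X : ℕ → Ω → EuclideanSpace ℝ (Fin n)}
    (hindep : Pairwise fun i j => X i ⟂ᵢ[P] X j) (hlaw : ∀ i, HasLaw (X i) μ P)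
    {Θ : Set (ι → EuclideanSpace ℝ (Fin n))} (hΘ : Θ = Set.univ ∨ IsCompact Θ)
    {ξs : ι → EuclideanSpace ℝ (Fin n)}
    (hξs : ∀ ξ ∈ Θ, ξ ≠ ξs → ∫ x, Real.log (gaussianMixture S ξ x) ∂μ <
      ∫ x, Real.log (gaussianMixture S ξs x) ∂μ)
    {ξhat : ℕ → Ω → ι → EuclideanSpace ℝ (Fin n)}
    (hξhat : ∀ᵐ ω ∂P, ∀ L : ℕ, 0 < L → ξhat L ω ∈ Θ ∧
      ∑ i ∈ Finset.range L, Real.log (gaussianMixture S ξs (X i ω)) ≤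
        ∑ i ∈ Finset.range L, Real.log (gaussianMixture S (ξhat L ω) (X i ω))) :
    ∀ᵐ ω ∂P, Tendsto (fun L => ξhat L ω) atTop (𝓝 ξs) := by
  obtain ⟨C, hC, hΘC, hCΘ⟩ : ∃ C : Set (ι → OnePoint (EuclideanSpace ℝ (Fin n))),
      IsCompact C ∧ (∀ ξ ∈ Θ, toOnePoint ξ ∈ C) ∧
        ∀ z ∈ C, z ∈ toOnePoint '' Θ ∨ Θ = Set.univ ∧ ∃ i, z i = OnePoint.infty := by
    rcases hΘ with rfl | hΘ
    · refine ⟨Set.univ, isCompact_univ, fun _ _ => trivial, fun z _ => ?_⟩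
      rw [Set.image_univ]
      exact (mem_range_toOnePoint_or_exists_eq_infty z).imp_right (And.intro rfl)
    · exact ⟨toOnePoint '' Θ, hΘ.image isInducing_toOnePoint.continuous,
        fun ξ hξ => Set.mem_image_of_mem _ hξ, fun z hz => Or.inl hz⟩
  refine ae_tendsto_of_sum_le (q := fun x ξ => Real.log (gaussianMixture S ξ x)) hindep hlaw
    (integrable_log_gaussianMixture hS hμ ξs) hC isInducing_toOnePoint (fun z hz hne => ?_)
    (hξhat.mono fun ω hω L hL => (hω L hL).imp_left (hΘC _))
  obtain ⟨ξ, hξ, rfl⟩ | ⟨rfl, hinf⟩ := hCΘ z hz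
  · exact hasEnvelopeBelow_log_gaussianMixture_coe hS hμ ξ
      (hξs ξ hξ fun h => hne (by rw [h]))
  · obtain ⟨ξ, hξ⟩ := exists_hasEnvelopeBelow_log_gaussianMixture_infty hS hμ hinf
    rcases eq_or_ne ξ ξs with rfl | hne
    · exact hξ
    · exact hξ.mono (hξs ξ trivial hne).le

end Nonempty

end GaussianMixture

section MeasureOfDensity

variable {n : ℕ} {f g : EuclideanSpace ℝ (Fin n) → ℝ}

theorem integrable_measureOfDensity_iff (hg : Measurable g) (hg0 : ∀ x, 0 ≤ g x)
    {F : EuclideanSpace ℝ (Fin n) → ℝ} :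
    Integrable F (measureOfDensity g) ↔ Integrable fun x => F x * g x := by
  rw [measureOfDensity, integrable_withDensity_iff hg.ennreal_ofReal
    (ae_of_all _ fun x => ENNReal.ofReal_lt_top)]
  simp only [ENNReal.toReal_ofReal (hg0 _)]

theorem ae_pos_measureOfDensity (hg : Measurable g) : ∀ᵐ x ∂measureOfDensity g, 0 < g x := by
  rw [measureOfDensity, ae_withDensity_iff hg.ennreal_ofReal]
  exact ae_of_all _ fun x hx => ENNReal.ofReal_pos.1 (pos_iff_ne_zero.2 hx)

theorem measureOfDensity_eq_iff (hf : Measurable f) (hg : Measurable g) (hf0 : ∀ x, 0 ≤ f x)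
    (hg0 : ∀ x, 0 ≤ g x) : measureOfDensity f = measureOfDensity g ↔ f =ᵐ[volume] g := by
  rw [measureOfDensity, measureOfDensity, withDensity_eq_iff_of_sigmaFinite
    hf.ennreal_ofReal.aemeasurable hg.ennreal_ofReal.aemeasurable]
  exact eventually_congr (ae_of_all _ fun x => ENNReal.ofReal_eq_ofReal_iff (hf0 x) (hg0 x))

theorem isProbabilityMeasure_measureOfDensity (hg : Integrable g) (hg0 : ∀ x, 0 ≤ g x)
    (hg1 : ∫ x, g x = 1) : IsProbabilityMeasure (measureOfDensity g) := by
  constructor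
  rw [measureOfDensity, withDensity_apply _ MeasurableSet.univ, Measure.restrict_univ,
    ← ofReal_integral_eq_lintegral_ofReal hg (ae_of_all _ hg0), hg1, ENNReal.ofReal_one]

theorem withDensity_div_measureOfDensity (hf : Measurable f) (hg : Measurable g)
    (hf0 : ∀ x, 0 < f x) :
    (measureOfDensity f).withDensity (fun x => ENNReal.ofReal (g x / f x)) =
      measureOfDensity g := by
  have hdiv : Measurable fun x => ENNReal.ofReal (g x / f x) := (hg.div hf).ennreal_ofReal
  rw [measureOfDensity, measureOfDensity, ← withDensity_mul _ hf.ennreal_ofReal hdiv]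
  congr 1 with x
  rw [Pi.mul_apply, ← ENNReal.ofReal_mul (hf0 x).le, mul_div_cancel₀ _ (hf0 x).ne']

theorem absolutelyContinuous_measureOfDensity (hf : Measurable f) (hg : Measurable g)
    (hf0 : ∀ x, 0 < f x) : measureOfDensity g ≪ measureOfDensity f :=
  withDensity_div_measureOfDensity hf hg hf0 ▸ withDensity_absolutelyContinuous _ _

theorem llr_measureOfDensity_ae_eq (hf : Measurable f) (hg : Measurable g) (hf0 : ∀ x, 0 < f x)
    (hg0 : ∀ x, 0 ≤ g x) [SigmaFinite (measureOfDensity f)] :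
    llr (measureOfDensity g) (measureOfDensity f) =ᵐ[measureOfDensity g]
      fun x => Real.log (g x / f x) := by
  have hdiv : Measurable fun x => ENNReal.ofReal (g x / f x) := (hg.div hf).ennreal_ofReal
  have hrn := Measure.rnDeriv_withDensity (measureOfDensity f) hdiv
  rw [withDensity_div_measureOfDensity hf hg hf0] at hrn
  filter_upwards [(absolutelyContinuous_measureOfDensity hf hg hf0).ae_le hrn] with x hx
  rw [llr, hx, ENNReal.toReal_ofReal (div_nonneg (hg0 x) (hf0 x).le)]

theorem integral_log_div_pos (hf : Measurable f) (hg : Measurable g) (hf0 : ∀ x, 0 < f x)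
    (hg0 : ∀ x, 0 ≤ g x) [IsProbabilityMeasure (measureOfDensity f)]
    [IsProbabilityMeasure (measureOfDensity g)]
    (hint : Integrable (fun x => Real.log (g x / f x)) (measureOfDensity g))
    (hne : measureOfDensity f ≠ measureOfDensity g) :
    0 < ∫ x, Real.log (g x / f x) ∂measureOfDensity g := by
  have hac := absolutelyContinuous_measureOfDensity hf hg hf0
  have hllr := llr_measureOfDensity_ae_eq hf hg hf0 hg0
  rw [← integral_congr_ae hllr, ← InformationTheory.toReal_klDiv_of_measure_eq hac
    (measure_univ.trans measure_univ.symm)]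
  exact ENNReal.toReal_pos (mt InformationTheory.klDiv_eq_zero_iff.1 hne.symm)
    (InformationTheory.klDiv_ne_top hac (hint.congr hllr.symm))

end MeasureOfDensity

section BoxUniformDensity

variable {n : ℕ} {a b : EuclideanSpace ℝ (Fin n)}

theorem axisBox_eq_preimage_Icc (a b : EuclideanSpace ℝ (Fin n)) : axisBox a b =
    (EuclideanSpace.equiv (Fin n) ℝ).toHomeomorph ⁻¹' Set.Icc a.ofLp b.ofLp := by
  ext x
  simp [axisBox, Pi.le_def, forall_and]

theorem isCompact_axisBox (a b : EuclideanSpace ℝ (Fin n)) : IsCompact (axisBox a b) := by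
  rw [axisBox_eq_preimage_Icc, Homeomorph.isCompact_preimage]
  exact isCompact_Icc

theorem interior_axisBox_nonempty (hab : ∀ i, a i < b i) : (interior (axisBox a b)).Nonempty := by
  rw [axisBox_eq_preimage_Icc, ← Homeomorph.preimage_interior, ← Set.pi_univ_Icc,
    interior_pi_set Set.finite_univ]
  simp only [interior_Icc]
  exact (Set.univ_pi_nonempty_iff.2 fun i => Set.nonempty_Ioo.2 (hab i)).preimage
    (Homeomorph.surjective _)

theorem axisBoxVolume_pos (hab : ∀ i, a i < b i) : 0 < axisBoxVolume a b :=
  Finset.prod_pos fun i _ => sub_pos.2 (hab i)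

theorem measurable_boxUniformDensity (a b : EuclideanSpace ℝ (Fin n)) :
    Measurable (boxUniformDensity a b) :=
  measurable_const.indicator (isCompact_axisBox a b).measurableSet

theorem boxUniformDensity_nonneg (hab : ∀ i, a i < b i) (x : EuclideanSpace ℝ (Fin n)) :
    0 ≤ boxUniformDensity a b x :=
  Set.indicator_nonneg (fun _ _ => one_div_nonneg.2 (axisBoxVolume_pos hab).le) x

theorem boxUniformDensity_le (hab : ∀ i, a i < b i) (x : EuclideanSpace ℝ (Fin n)) :
    boxUniformDensity a b x ≤ 1 / axisBoxVolume a b :=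
  Set.indicator_le_self' (fun _ _ => one_div_nonneg.2 (axisBoxVolume_pos hab).le) x

theorem integrable_norm_sq_mul_boxUniformDensity (a b : EuclideanSpace ℝ (Fin n)) :
    Integrable fun x => ‖x‖ ^ 2 * boxUniformDensity a b x := by
  have hcont : ContinuousOn (fun x : EuclideanSpace ℝ (Fin n) =>
      ‖x‖ ^ 2 * (1 / axisBoxVolume a b)) (axisBox a b) := by fun_prop
  refine ((integrable_indicator_iff (isCompact_axisBox a b).measurableSet).2
    (hcont.integrableOn_compact (μ := volume) (isCompact_axisBox a b))).congr
    (ae_of_all _ fun x => ?_)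
  simp only [Set.indicator_mul_right, boxUniformDensity]

theorem not_ae_eq_indicator_of_continuous {E : Type*} [TopologicalSpace E] [PreconnectedSpace E]
    [MeasurableSpace E] [OpensMeasurableSpace E] {μ : Measure E} [μ.IsOpenPosMeasure] {B : Set E}
    (hB : IsClosed B) (hint : (interior B).Nonempty) (hne : B ≠ Set.univ)
    {c : ℝ} (hc : c ≠ 0) {F : E → ℝ} (hF : Continuous F) :
    ¬ F =ᵐ[μ] B.indicator fun _ => c := by
  intro h
  have hin : Set.EqOn F (fun _ => c) (interior B) := by
    refine Measure.eqOn_open_of_ae_eq (μ := μ) ?_ isOpen_interior hF.continuousOn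
      continuousOn_const
    filter_upwards [ae_restrict_of_ae h, ae_restrict_mem isOpen_interior.measurableSet]
      with x hx hxB
    rw [hx, Set.indicator_of_mem (interior_subset hxB)]
  have hout : Set.EqOn F (fun _ => 0) Bᶜ := by
    refine Measure.eqOn_open_of_ae_eq (μ := μ) ?_ hB.isOpen_compl hF.continuousOn
      continuousOn_const
    filter_upwards [ae_restrict_of_ae h, ae_restrict_mem hB.isOpen_compl.measurableSet]
      with x hx hxB
    rw [hx, Set.indicator_of_notMem hxB]
  obtain ⟨x, hx⟩ : (frontier (interior B)).Nonempty := nonempty_frontier_iff.2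
    ⟨hint, fun huniv => hne (Set.univ_subset_iff.1 (huniv ▸ interior_subset))⟩
  rw [isOpen_interior.frontier_eq] at hx
  have hxc : x ∈ closure Bᶜ := by
    rw [closure_compl]
    exact hx.2
  exact hc ((hin.closure hF continuous_const hx.1).symm.trans
    (hout.closure hF continuous_const hxc))

end BoxUniformDensity

section DataDensity

variable {n M : ℕ} {w : ℝ} {S : Matrix (Fin n) (Fin n) ℝ} {y : Fin M → EuclideanSpace ℝ (Fin n)}
  {a b : EuclideanSpace ℝ (Fin n)}

theorem dataDensity_eq (w : ℝ) (S : Matrix (Fin n) (Fin n) ℝ)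
    (y : Fin M → EuclideanSpace ℝ (Fin n)) (a b x : EuclideanSpace ℝ (Fin n)) :
    dataDensity w S y a b x = (1 - w) * gaussianMixture S y x + w * boxUniformDensity a b x := by
  rw [dataDensity, gaussianMixture, Fintype.card_fin, one_div, mul_assoc]

theorem measurable_dataDensity (w : ℝ) (S : Matrix (Fin n) (Fin n) ℝ)
    (y : Fin M → EuclideanSpace ℝ (Fin n)) (a b : EuclideanSpace ℝ (Fin n)) :
    Measurable (dataDensity w S y a b) := by
  rw [funext (dataDensity_eq w S y a b)]
  exact ((continuous_gaussianMixture S y).measurable.const_mul _).add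
    ((measurable_boxUniformDensity a b).const_mul _)

theorem integrable_norm_sq_mul_gaussianMixture {ι : Type*} [Fintype ι] (hS : S.PosDef)
    (ξ : ι → EuclideanSpace ℝ (Fin n)) :
    Integrable fun x => ‖x‖ ^ 2 * gaussianMixture S ξ x := by
  simp only [gaussianMixture, mul_left_comm (‖_‖ ^ 2), Finset.mul_sum _ _ (‖_‖ ^ 2)]
  exact (integrable_finsetSum _ fun i _ =>
    integrable_norm_sq_mul_gaussianDensity hS (ξ i)).const_mul _

variable (hw0 : 0 ≤ w) (hw1 : w ≤ 1) (hab : ∀ i, a i < b i)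
include hw0 hw1 hab

theorem dataDensity_nonneg (S : Matrix (Fin n) (Fin n) ℝ) (y : Fin M → EuclideanSpace ℝ (Fin n))
    (x : EuclideanSpace ℝ (Fin n)) : 0 ≤ dataDensity w S y a b x := by
  rw [dataDensity_eq]
  exact add_nonneg (mul_nonneg (sub_nonneg.2 hw1)
    (extendedGaussianMixture_nonneg S (toOnePoint y) x))
    (mul_nonneg hw0 (boxUniformDensity_nonneg hab x))

theorem memLp_id_two_dataDensity (hS : S.PosDef) (y : Fin M → EuclideanSpace ℝ (Fin n)) :
    MemLp id 2 (measureOfDensity (dataDensity w S y a b)) := by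
  rw [memLp_two_iff_integrable_sq_norm aestronglyMeasurable_id,
    integrable_measureOfDensity_iff (measurable_dataDensity w S y a b)
      (dataDensity_nonneg hw0 hw1 hab S y)]
  simp only [dataDensity_eq, id, mul_add, mul_left_comm (‖_‖ ^ 2)]
  exact ((integrable_norm_sq_mul_gaussianMixture hS y).const_mul _).add
    ((integrable_norm_sq_mul_boxUniformDensity a b).const_mul _)

theorem integrable_log_dataDensity [NeZero M] (hS : S.PosDef)
    (y : Fin M → EuclideanSpace ℝ (Fin n))
    [IsFiniteMeasure (measureOfDensity (dataDensity w S y a b))] :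
    Integrable (fun x => Real.log (dataDensity w S y a b x))
      (measureOfDensity (dataDensity w S y a b)) := by
  have hmeas := measurable_dataDensity w S y a b
  have hμ := memLp_id_two_dataDensity hw0 hw1 hab hS y
  rcases hw1.lt_or_eq with hw | rfl
  · have hw' : 0 < 1 - w := sub_pos.2 hw
    refine integrable_log_of_le_of_le hmeas.aemeasurable
      (p := fun x => (1 - w) * gaussianMixture S y x)
      (C := (1 - w) * gaussianPeak S + w * (1 / axisBoxVolume a b))
      (fun x => mul_pos hw' (gaussianMixture_pos hS y x)) (fun x => ?_) (fun x => ?_) ?_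
    · rw [dataDensity_eq]
      exact le_add_of_nonneg_right (mul_nonneg hw0 (boxUniformDensity_nonneg hab x))
    · rw [dataDensity_eq]
      gcongr
      · exact gaussianMixture_le hS y x
      · exact boxUniformDensity_le hab x
    · simp only [Real.log_mul hw'.ne' (gaussianMixture_pos hS y _).ne']
      exact (integrable_const _).add (integrable_log_gaussianMixture hS hμ y)
  · refine (integrable_const (Real.log (1 / axisBoxVolume a b))).congr ?_
    filter_upwards [ae_pos_measureOfDensity hmeas] with x hx
    rw [dataDensity_eq, sub_self, zero_mul, zero_add, one_mul] at hx ⊢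
    rw [boxUniformDensity, Set.indicator_of_mem (Set.mem_of_indicator_ne_zero hx.ne')]

theorem measureOfDensity_ne_measureOfDensity_dataDensity [NeZero n] (hw : w ≠ 0)
    (S : Matrix (Fin n) (Fin n) ℝ) (y : Fin M → EuclideanSpace ℝ (Fin n))
    {f : EuclideanSpace ℝ (Fin n) → ℝ} (hf : Continuous f) (hf0 : ∀ x, 0 ≤ f x) :
    measureOfDensity f ≠ measureOfDensity (dataDensity w S y a b) := by
  rw [Ne, measureOfDensity_eq_iff hf.measurable (measurable_dataDensity w S y a b) hf0
    (dataDensity_nonneg hw0 hw1 hab S y)]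
  intro h
  refine not_ae_eq_indicator_of_continuous (μ := volume) (isCompact_axisBox a b).isClosed
    (interior_axisBox_nonempty hab) (isCompact_axisBox a b).ne_univ
    (mul_ne_zero hw (one_div_pos.2 (axisBoxVolume_pos hab)).ne')
    (hf.sub ((continuous_gaussianMixture S y).const_mul (1 - w))) ?_
  filter_upwards [h] with x hx
  rw [Pi.sub_apply, hx, dataDensity_eq, add_sub_cancel_left, boxUniformDensity,
    ← Set.indicator_const_mul]

end DataDensity

section MixtureDensity

variable {n K : ℕ} {σ : ℝ} (hσ : 0 < σ)
include hσ

theorem posDef_sq_smul_one : (σ ^ 2 • (1 : Matrix (Fin n) (Fin n) ℝ)).PosDef :=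
  Matrix.PosDef.one.smul (pow_pos hσ 2)

theorem gaussianDensity_sq_smul_one (y x : EuclideanSpace ℝ (Fin n)) :
    gaussianDensity (σ ^ 2 • 1) y x = 1 / (2 * Real.pi * σ ^ 2) ^ ((n : ℝ) / 2) *
      Real.exp (-(1 / (2 * σ ^ 2)) * ‖x - y‖ ^ 2) := by
  have hpeak : Real.sqrt ((2 * Real.pi) ^ n * (σ ^ 2 • (1 : Matrix (Fin n) (Fin n) ℝ)).det) =
      (2 * Real.pi * σ ^ 2) ^ ((n : ℝ) / 2) := by
    rw [Matrix.det_smul, Matrix.det_one, mul_one, Fintype.card_fin, ← mul_pow, Real.sqrt_eq_rpow,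
      ← Real.rpow_natCast_mul (by positivity), mul_one_div]
  have hinv : (σ ^ 2 • (1 : Matrix (Fin n) (Fin n) ℝ))⁻¹ = (σ ^ 2)⁻¹ • 1 :=
    Matrix.inv_eq_left_inv (by
      rw [smul_mul_smul_comm, one_mul, inv_mul_cancel₀ (pow_pos hσ 2).ne', one_smul])
  have hnorm : (x - y).ofLp ⬝ᵥ (x - y).ofLp = ‖x - y‖ ^ 2 := by
    rw [EuclideanSpace.real_norm_sq_eq, dotProduct]
    simp only [sq]
  rw [gaussianDensity, hpeak, hinv, Matrix.smul_mulVec, Matrix.one_mulVec, dotProduct_smul, hnorm,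
    smul_eq_mul]
  ring_nf

theorem mixtureDensity_eq_gaussianMixture (u : EuclideanSpace ℝ (Fin n))
    (ξ : Fin K → EuclideanSpace ℝ (Fin n)) :
    mixtureDensity σ u ξ = gaussianMixture (σ ^ 2 • 1) ξ u := by
  simp only [mixtureDensity, gaussianMixture, gaussianDensity_sq_smul_one hσ, Fintype.card_fin,
    one_div]

theorem continuous_mixtureDensity (ξ : Fin K → EuclideanSpace ℝ (Fin n)) :
    Continuous fun u => mixtureDensity σ u ξ := by
  simp only [mixtureDensity_eq_gaussianMixture hσ]
  exact continuous_gaussianMixture _ ξ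

theorem mixtureDensity_pos [NeZero K] (ξ : Fin K → EuclideanSpace ℝ (Fin n))
    (u : EuclideanSpace ℝ (Fin n)) : 0 < mixtureDensity σ u ξ := by
  rw [mixtureDensity_eq_gaussianMixture hσ]
  exact gaussianMixture_pos (posDef_sq_smul_one hσ) ξ u

theorem integral_gaussianDensity_sq_smul_one (y : EuclideanSpace ℝ (Fin n)) :
    ∫ x, gaussianDensity (σ ^ 2 • 1) y x = 1 := by
  have hvar : Real.pi / (1 / (2 * σ ^ 2)) = 2 * Real.pi * σ ^ 2 := by
    field_simp
  simp only [gaussianDensity_sq_smul_one hσ]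
  rw [integral_const_mul, integral_sub_right_eq_self (fun x : EuclideanSpace ℝ (Fin n) =>
      Real.exp (-(1 / (2 * σ ^ 2)) * ‖x‖ ^ 2)),
    GaussianFourier.integral_rexp_neg_mul_sq_norm (by positivity), finrank_euclideanSpace_fin, hvar]
  exact one_div_mul_cancel (by positivity)

theorem isProbabilityMeasure_measureOfDensity_mixtureDensity [NeZero K]
    (ξ : Fin K → EuclideanSpace ℝ (Fin n)) :
    IsProbabilityMeasure (measureOfDensity fun u => mixtureDensity σ u ξ) := by
  have hint : ∀ i, Integrable (gaussianDensity (σ ^ 2 • 1) (ξ i)) := fun i =>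
    .of_integral_ne_zero (by
      rw [integral_gaussianDensity_sq_smul_one hσ]
      exact one_ne_zero)
  simp only [mixtureDensity_eq_gaussianMixture hσ]
  refine isProbabilityMeasure_measureOfDensity
    ((integrable_finsetSum _ fun i _ => hint i).const_mul _)
    (fun x => (gaussianMixture_pos (posDef_sq_smul_one hσ) ξ x).le) ?_
  simp only [gaussianMixture]
  rw [integral_const_mul, integral_finsetSum _ fun i _ => hint i]
  simp only [integral_gaussianDensity_sq_smul_one hσ, Finset.sum_const, Finset.card_univ,
    nsmul_eq_mul, mul_one]
  exact inv_mul_cancel₀ (Nat.cast_ne_zero.2 Fintype.card_ne_zero)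

end MixtureDensity

section Consistency

theorem IsUniqueMinimizerOn.lt {α : Type*} {I : α → ℝ} {Θ : Set α} {ξs ξ : α}
    (hξs : IsUniqueMinimizerOn I Θ ξs) (hξ : ξ ∈ Θ) (hne : ξ ≠ ξs) : I ξs < I ξ := by
  by_contra! hle
  exact hne (hξs.2.2 ξ hξ fun η hη => hle.trans (hξs.2.1 hη))

variable {n K : ℕ} {σ : ℝ} {Θ : Set (Fin K → EuclideanSpace ℝ (Fin n))}

theorem IsQMLE.sum_log_gaussianMixture_le {x : ℕ → EuclideanSpace ℝ (Fin n)} {L : ℕ}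
    {ξhat ξ : Fin K → EuclideanSpace ℝ (Fin n)} (hξhat : IsQMLE σ Θ x L ξhat) (hσ : 0 < σ)
    (hL : 0 < L) (hξ : ξ ∈ Θ) :
    ∑ i ∈ Finset.range L, Real.log (gaussianMixture (σ ^ 2 • 1) ξ (x i)) ≤
      ∑ i ∈ Finset.range L, Real.log (gaussianMixture (σ ^ 2 • 1) ξhat (x i)) := by
  simp only [← mixtureDensity_eq_gaussianMixture hσ]
  exact le_of_mul_le_mul_left (hξhat.2 hξ) (one_div_pos.2 (Nat.cast_pos.2 hL))

variable [NeZero K] {g : EuclideanSpace ℝ (Fin n) → ℝ} (hσ : 0 < σ) (hg : Measurable g)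
include hσ hg

theorem log_div_mixtureDensity_ae_eq (ξ : Fin K → EuclideanSpace ℝ (Fin n)) :
    (fun u => Real.log (g u / mixtureDensity σ u ξ)) =ᵐ[measureOfDensity g]
      fun u => Real.log (g u) - Real.log (gaussianMixture (σ ^ 2 • 1) ξ u) := by
  filter_upwards [ae_pos_measureOfDensity hg] with u hu
  rw [Real.log_div hu.ne' (mixtureDensity_pos hσ ξ u).ne', mixtureDensity_eq_gaussianMixture hσ]

variable [IsFiniteMeasure (measureOfDensity g)] (hμ : MemLp id 2 (measureOfDensity g))
  (hlog : Integrable (fun u => Real.log (g u)) (measureOfDensity g))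
include hμ hlog

theorem integrable_log_div_mixtureDensity (ξ : Fin K → EuclideanSpace ℝ (Fin n)) :
    Integrable (fun u => Real.log (g u / mixtureDensity σ u ξ)) (measureOfDensity g) :=
  (hlog.sub (integrable_log_gaussianMixture (posDef_sq_smul_one hσ) hμ ξ)).congr
    (log_div_mixtureDensity_ae_eq hσ hg ξ).symm

theorem klic_eq_sub (ξ : Fin K → EuclideanSpace ℝ (Fin n)) :
    klic g σ ξ = ∫ u, Real.log (g u) ∂measureOfDensity g -
      ∫ u, Real.log (gaussianMixture (σ ^ 2 • 1) ξ u) ∂measureOfDensity g := by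
  rw [klic, integral_congr_ae (log_div_mixtureDensity_ae_eq hσ hg ξ),
    integral_sub hlog (integrable_log_gaussianMixture (posDef_sq_smul_one hσ) hμ ξ)]

theorem IsUniqueMinimizerOn.integral_log_gaussianMixture_lt
    {ξs ξ : Fin K → EuclideanSpace ℝ (Fin n)} (hξs : IsUniqueMinimizerOn (klic g σ) Θ ξs)
    (hξ : ξ ∈ Θ) (hne : ξ ≠ ξs) :
    ∫ u, Real.log (gaussianMixture (σ ^ 2 • 1) ξ u) ∂measureOfDensity g <
      ∫ u, Real.log (gaussianMixture (σ ^ 2 • 1) ξs u) ∂measureOfDensity g := by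
  have hlt := hξs.lt hξ hne
  rwa [klic_eq_sub hσ hg hμ hlog, klic_eq_sub hσ hg hμ hlog, sub_lt_sub_iff_left] at hlt

end Consistency

theorem theorem3_general {n M K : ℕ} (hn : 0 < n) (hM : 0 < M) (hK : 0 < K)
    (w : ℝ) (hw0 : 0 < w) (hw1 : w ≤ 1)
    (S : Matrix (Fin n) (Fin n) ℝ) (hS : S.PosDef)
    (y : Fin M → EuclideanSpace ℝ (Fin n))
    (a b : EuclideanSpace ℝ (Fin n)) (hab : ∀ i, a i < b i)
    (σ : ℝ) (hσ : 0 < σ)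
    (Θ : Set (Fin K → EuclideanSpace ℝ (Fin n))) (hΘ : Θ = Set.univ ∨ IsCompact Θ)
    (ξs : Fin K → EuclideanSpace ℝ (Fin n))
    (hξs : IsUniqueMinimizerOn (klic (dataDensity w S y a b) σ) Θ ξs)
    {Ω : Type*} [MeasurableSpace Ω] (P : Measure Ω) [IsProbabilityMeasure P]
    (X : ℕ → Ω → EuclideanSpace ℝ (Fin n))
    (hindep : Pairwise fun i j => X i ⟂ᵢ[P] X j)
    (hlaw : ∀ i, HasLaw (X i) (measureOfDensity (dataDensity w S y a b)) P)
    (ξhat : ℕ → Ω → Fin K → EuclideanSpace ℝ (Fin n))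
    (hξhat : ∀ᵐ ω ∂P, ∀ L : ℕ, 0 < L → IsQMLE σ Θ (fun i => X i ω) L (ξhat L ω)) :
    (∀ᵐ ω ∂P, Tendsto (fun L => ξhat L ω) atTop (𝓝 ξs)) ∧
    (∀ ξ : Fin K → EuclideanSpace ℝ (Fin n),
      Integrable (fun u => Real.log (dataDensity w S y a b u / mixtureDensity σ u ξ))
        (measureOfDensity (dataDensity w S y a b))) ∧
    0 < klic (dataDensity w S y a b) σ ξs ∧
    (∀ ξ : Fin K → EuclideanSpace ℝ (Fin n),
      measureOfDensity (fun u => mixtureDensity σ u ξ) ≠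
        measureOfDensity (dataDensity w S y a b)) := by
  have : NeZero n := ⟨hn.ne'⟩
  have : NeZero M := ⟨hM.ne'⟩
  have : NeZero K := ⟨hK.ne'⟩
  have : IsProbabilityMeasure (measureOfDensity (dataDensity w S y a b)) :=
    (hlaw 0).map_eq ▸ Measure.isProbabilityMeasure_map (hlaw 0).aemeasurable
  have hg := measurable_dataDensity w S y a b
  have hμ := memLp_id_two_dataDensity hw0.le hw1 hab hS y
  have hlog := integrable_log_dataDensity hw0.le hw1 hab hS y
  have hint := integrable_log_div_mixtureDensity (K := K) hσ hg hμ hlog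
  have hne : ∀ ξ : Fin K → EuclideanSpace ℝ (Fin n),
      measureOfDensity (fun u => mixtureDensity σ u ξ) ≠
        measureOfDensity (dataDensity w S y a b) := fun ξ =>
    measureOfDensity_ne_measureOfDensity_dataDensity hw0.le hw1 hab hw0.ne' S y
      (continuous_mixtureDensity hσ ξ) fun u => (mixtureDensity_pos hσ ξ u).le
  refine ⟨?_, hint, ?_, hne⟩
  · exact ae_tendsto_of_sum_log_gaussianMixture_le (posDef_sq_smul_one hσ) hμ hindep hlaw hΘ
      (fun ξ hξ hne => hξs.integral_log_gaussianMixture_lt hσ hg hμ hlog hξ hne)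
      (hξhat.mono fun ω hω L hL =>
        ⟨(hω L hL).1, (hω L hL).sum_log_gaussianMixture_le hσ hL hξs.1⟩)
  · have := isProbabilityMeasure_measureOfDensity_mixtureDensity hσ ξs
    exact integral_log_div_pos (continuous_mixtureDensity hσ ξs).measurable hg
      (mixtureDensity_pos hσ ξs) (dataDensity_nonneg hw0.le hw1 hab S y) (hint ξs) (hne ξs)

theorem theorem3 {n M K : ℕ} (hn : 0 < n) (hM : 0 < M) (hK : 0 < K)
    -- the data model: weight of the uniform part, noise covariance, sources, bounding box
    (w : ℝ) (hw0 : 0 < w) (hw1 : w ≤ 1)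
    (S : Matrix (Fin n) (Fin n) ℝ) (hS : S.PosDef)
    (y : Fin M → EuclideanSpace ℝ (Fin n))
    (a b : EuclideanSpace ℝ (Fin n)) (hab : ∀ i, a i < b i)
    -- the approximating family and its parameter set
    (σ : ℝ) (hσ : 0 < σ)
    (Θ : Set (Fin K → EuclideanSpace ℝ (Fin n))) (hΘ : Θ = Set.univ ∨ IsCompact Θ)
    -- the expectation of the data density exists, and the KLIC has a unique minimizer
    (hE : Integrable (dataDensity w S y a b) (measureOfDensity (dataDensity w S y a b)))
    (ξs : Fin K → EuclideanSpace ℝ (Fin n))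
    (hξs : IsUniqueMinimizerOn (klic (dataDensity w S y a b) σ) Θ ξs)
    -- i.i.d. observations from the data model
    {Ω : Type*} [MeasurableSpace Ω] (P : Measure Ω) [IsProbabilityMeasure P]
    (X : ℕ → Ω → EuclideanSpace ℝ (Fin n)) (hindep : iIndepFun X P)
    (hlaw : ∀ i, HasLaw (X i) (measureOfDensity (dataDensity w S y a b)) P)
    -- the quasi-maximum-likelihood estimators
    (ξhat : ℕ → Ω → Fin K → EuclideanSpace ℝ (Fin n))
    (hξhat : ∀ᵐ ω ∂P, ∀ L : ℕ, 0 < L → IsQMLE σ Θ (fun i => X i ω) L (ξhat L ω)) :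
    (∀ᵐ ω ∂P, Tendsto (fun L => ξhat L ω) atTop (𝓝 ξs)) ∧
    (∀ ξ : Fin K → EuclideanSpace ℝ (Fin n),
      Integrable (fun u => Real.log (dataDensity w S y a b u / mixtureDensity σ u ξ))
        (measureOfDensity (dataDensity w S y a b))) ∧
    0 < klic (dataDensity w S y a b) σ ξs ∧
    (∀ ξ : Fin K → EuclideanSpace ℝ (Fin n),
      measureOfDensity (fun u => mixtureDensity σ u ξ) ≠
        measureOfDensity (dataDensity w S y a b)) :=
  theorem3_general hn hM hK w hw0 hw1 S hS y a b hab σ hσ Θ hΘ ξs hξs P X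
    (fun _ _ hij => hindep.indepFun hij) hlaw ξhat hξhat
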